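/- Let $T_0>0$, let $H$ and $U$ be complex Hilbert spaces, let $A$ be an unbounded operator on $H$ generating a strongly continuous semigroup $(e^{tA})_{t\ge 0}$ of bounded operators on $H$, and let $B\colon U\to H$ be a bounded linear operator. For every $T>0$, let $U_T$ be a complex Hilbert space that is a subspace of $L^2(0,T;U)$ with continuous and dense injection. Assume the following extension-by-zero property: if $T,a,b>0$ and $u\in U_T$, then the function $\widetilde u$ on $(0,T+a+b)$ defined by $\widetilde u(t)=u(t-a)$ for $a<t<T+a$ and $\widetilde u(t)=0$ for $0<t<a$ and for $T+a<t<T+a+b$ belongs to $U_{T+a+b}$. For $f_0\in H$ and $u\in L^2(0,T;U)$, the solution of $f'=Af+Bu$, $f(0)=f_0$ is the mild solution $f(t)=e^{tA}f_0+\int_0^t e^{(t-s)A}Bu(s)\,ds$, $0\le t\le T$. A generalized eigenvector of $A^*$ is an element of $\ker (A^*-\mu)^k$ for some $\mu\in\mathbb C$ and $k\ge 1$, and $e^{tA^*}=(e^{tA})^*$. Assume that there exist a finite-dimensional subspace $\mathcal F$ of $H$ with $e^{tA}\mathcal F\subset\mathcal F$ for all $t\ge 0$, and a closed subspace $\mathcal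 G$ of $H$ of finite codimension (not required to be invariant under $e^{tA}$), such that: 1. (control up to finite dimension) for every $f_0\in\mathcal G$, there exists $u\in U_{T_0}$ such that the solution of $f'=Af+Bu$, $f(0)=f_0$ satisfies $f(T_0)\in\mathcal F$; 2. (unique continuation) for every $\epsilon>0$ and every finite linear combination $g_0\in H$ of generalized eigenvectors of $A^*$, if $B^*e^{tA^*}g_0=0$ for all $t\in(0,\epsilon)$, then $g_0=0$. Then, for every $T>T_0$ and every $f_0\in H$, there exists $u\in U_T$ such that the solution of $f'=Af+Bu$, $f(0)=f_0$ satisfies $f(T)=0$. -/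

import Mathlib

open MeasureTheory Filter Topology Set

noncomputable section

variable {H : Type*} [NormedAddCommGroup H] [InnerProductSpace ℂ H]

/-- `S` is a strongly continuous semigroup of bounded operators on `H`. Only the values `S t` with
`0 ≤ t` are relevant. -/
structure IsC0Semigroup (S : ℝ → H →L[ℂ] H) : Prop where
  map_zero : S 0 = ContinuousLinearMap.id ℂ H
  map_add : ∀ s t : ℝ, 0 ≤ s → 0 ≤ t → S (s + t) = (S s).comp (S t)
  continuousOn : ∀ x : H, ContinuousOn (fun t : ℝ => S t x) (Ici 0)

/-- The unbounded operator `A` generates the strongly continuous semigroup `S`, i.e. `S t = e^{tA}`: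
the graph of `A` is exactly the set of pairs `(x, y)` with `(S t x - x) / t → y` as `t → 0⁺`. -/
structure Generates (A : H →ₗ.[ℂ] H) (S : ℝ → H →L[ℂ] H) : Prop where
  isC0Semigroup : IsC0Semigroup S
  mem_graph_iff : ∀ x y : H, (x, y) ∈ A.graph ↔
    Tendsto (fun t : ℝ => (t : ℂ)⁻¹ • (S t x - x)) (𝓝[>] 0) (𝓝 y)

/-- `g` lies in the domain of `(A - μ)^k` and `(A - μ)^k g = 0`. -/
def InKerPow (A : H →ₗ.[ℂ] H) (μ : ℂ) : ℕ → H → Prop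
  | 0, g => g = 0
  | k + 1, g => ∃ hg : g ∈ A.domain, InKerPow A μ k (A ⟨g, hg⟩ - μ • g)

/-- The space of finite linear combinations of generalized eigenvectors of `A`
(for arbitrary, possibly different, eigenvalues). -/
def genEigenSpan (A : H →ₗ.[ℂ] H) : Submodule ℂ H :=
  Submodule.span ℂ {g : H | ∃ (μ : ℂ) (k : ℕ), InKerPow A μ k g}

/-- The space `L²(0,T; U)`. -/
abbrev L2Control (U : Type*) [NormedAddCommGroup U] (T : ℝ) : Type _ :=
  Lp U 2 (volume.restrict (Ioo (0 : ℝ) T))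

/-- The value at time `t` of the (mild) solution of `f' = A f + B u`, `f 0 = f₀`, where `S` is the
semigroup generated by `A`: the Duhamel formula
`f t = S t f₀ + ∫ s in 0..t, S (t - s) (B (u s))`. -/
def mildSolution {U : Type*} [NormedAddCommGroup U] [InnerProductSpace ℂ U]
    (S : ℝ → H →L[ℂ] H) (B : U →L[ℂ] H) (f₀ : H) (u : ℝ → U) (t : ℝ) : H :=
  S t f₀ + ∫ s in (0 : ℝ)..t, S (t - s) (B (u s))

end

/-! Let `R t` be the space of states reachable from `0` at time `t`, and `N t` the space of states
that can be steered to `0` in time `t`. Control up to `F` makes `N T₀` of finite codimension, and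
extension by zero makes the codimension of `N t` nonincreasing in `t`. Hence `N t` is equal to a
fixed space `N` on some interval `(T₁, T)` with `T₁ > T₀`. The space `N` is closed because a
finite-codimensional range of a bounded operator is closed; since `N t` is constant, `N` is
invariant under `e^{tA}` and contains `R t` for small `t`. Therefore `Nᗮ` is finite-dimensional and
consists of combinations of generalized eigenvectors of the adjoint of `A`, and `B* e^{tA*}`
vanishes on `Nᗮ` for small `t`. Unique continuation gives `Nᗮ = 0`. -/

section LinearAlgebra

variable {K V W : Type*} [DivisionRing K] [AddCommGroup V] [Module K V] [AddCommGroup W]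
  [Module K W]

theorem injective_mapQ_comap (f : V →ₗ[K] W) (N : Submodule K W) :
    Function.Injective ((N.comap f).mapQ N f le_rfl) := by
  rw [← LinearMap.ker_eq_bot, Submodule.ker_mapQ, Submodule.mkQ_map_self]

theorem cofg_comap (f : V →ₗ[K] W) (N : Submodule K W) [N.CoFG] : (N.comap f).CoFG :=
  Module.Finite.of_injective _ (injective_mapQ_comap f N)

theorem finrank_quotient_comap_le (f : V →ₗ[K] W) (N : Submodule K W) [N.CoFG] :
    Module.finrank K (V ⧸ N.comap f) ≤ Module.finrank K (W ⧸ N) :=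
  LinearMap.finrank_le_finrank_of_injective (injective_mapQ_comap f N)

theorem finrank_quotient_le_of_le {N M : Submodule K V} (h : N ≤ M) [N.CoFG] :
    Module.finrank K (V ⧸ M) ≤ Module.finrank K (V ⧸ N) :=
  LinearMap.finrank_le_finrank_of_surjective (Submodule.factor_surjective h)

theorem eq_of_le_of_finrank_quotient_le {N M : Submodule K V} [hN : N.CoFG] (h : N ≤ M)
    (hr : Module.finrank K (V ⧸ N) ≤ Module.finrank K (V ⧸ M)) : N = M := by
  have : M.CoFG := hN.of_le h
  have hinj : Function.Injective (Submodule.factor h) :=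
    (LinearMap.injective_iff_surjective_of_finrank_eq_finrank
      (hr.antisymm (finrank_quotient_le_of_le h))).2 (Submodule.factor_surjective h)
  refine h.antisymm fun x hx => (Submodule.Quotient.mk_eq_zero N).1 (hinj ?_)
  rw [map_zero]
  exact (Submodule.Quotient.mk_eq_zero M).2 hx

theorem exists_map_sub_mem_of_comap_eq {f : V →ₗ[K] V} {N : Submodule K V} [N.CoFG]
    (h : N.comap f = N) (y : V) : ∃ x, f x - y ∈ N := by
  have hinj : Function.Injective (N.mapQ N f h.ge) := by
    rw [← LinearMap.ker_eq_bot, Submodule.ker_mapQ, h, Submodule.mkQ_map_self]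
  obtain ⟨q, hq⟩ := LinearMap.injective_iff_surjective.1 hinj (Submodule.Quotient.mk y)
  obtain ⟨x, rfl⟩ := Submodule.Quotient.mk_surjective _ q
  exact ⟨x, (Submodule.Quotient.eq N).1 hq⟩

theorem cofg_comap_of_map_le_sup {f : V →ₗ[K] W} {G : Submodule K V} {F R : Submodule K W}
    (hG : G.CoFG) (hF : F.FG) (h : G.map f ≤ F ⊔ R) : (R.comap f).CoFG := by
  obtain ⟨C, hC⟩ := G.exists_isCompl
  have hrange : (R.mkQ ∘ₗ f).range ≤ F.map R.mkQ ⊔ C.map (R.mkQ ∘ₗ f) := by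
    rw [LinearMap.range_eq_map, ← hC.sup_eq_top, Submodule.map_sup]
    gcongr
    calc G.map (R.mkQ ∘ₗ f) = (G.map f).map R.mkQ := Submodule.map_comp _ _ _
      _ ≤ (F ⊔ R).map R.mkQ := Submodule.map_mono h
      _ = F.map R.mkQ := by rw [Submodule.map_sup, Submodule.mkQ_map_self, sup_bot_eq]
  have hfg : (R.mkQ ∘ₗ f).range.FG :=
    ((hF.map _).sup ((hG.fg_of_isCompl hC).map _)).of_le hrange
  simpa only [LinearMap.ker_comp, Submodule.ker_mkQ] using Submodule.range_fg_iff_ker_cofg.1 hfg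

end LinearAlgebra

section ClosedRange

variable {𝕜 E V W : Type*} [NontriviallyNormedField 𝕜] [CompleteSpace 𝕜]
  [NormedAddCommGroup E] [NormedSpace 𝕜 E] [CompleteSpace E]
  [NormedAddCommGroup V] [NormedSpace 𝕜 V] [CompleteSpace V]
  [NormedAddCommGroup W] [NormedSpace 𝕜 W]

theorem isClosed_range_of_cofg [CompleteSpace W] (f : V →L[𝕜] W) (hf : f.range.CoFG) :
    IsClosed (f.range : Set W) := by
  obtain ⟨C, hC⟩ := f.range.exists_isCompl
  have : FiniteDimensional 𝕜 C := .of_fg (hf.fg_of_isCompl hC)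
  have : CompleteSpace C := FiniteDimensional.complete 𝕜 C
  let g : V × C →L[𝕜] W := f.coprod C.subtypeL
  have hg : Function.Surjective g := by
    intro y
    have hy : y ∈ f.range ⊔ C := hC.sup_eq_top ▸ Submodule.mem_top
    obtain ⟨_, ⟨x, rfl⟩, c, hc, hxc⟩ := Submodule.mem_sup.1 hy
    exact ⟨(x, ⟨c, hc⟩), hxc⟩
  have hpre : g ⁻¹' f.range = {p | p.2 = 0} := by
    ext ⟨x, c⟩
    have hfx : f x ∈ f.range := ⟨x, rfl⟩
    have hiff : f x + c ∈ f.range ↔ (c : W) ∈ f.range := Submodule.add_mem_iff_right _ hfx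
    refine hiff.trans ⟨fun hc => ?_, fun hc => ?_⟩
    · exact Subtype.ext (Submodule.disjoint_def.1 hC.disjoint c hc c.2)
    · rw [show c = 0 from hc]
      exact zero_mem _
  rw [← (g.isQuotientMap hg).isClosed_preimage, hpre]
  exact isClosed_eq continuous_snd continuous_const

theorem isClosed_comap_range_of_cofg (f : E →L[𝕜] W) (g : V →L[𝕜] W)
    (h : (g.range.comap (f : E →ₗ[𝕜] W)).CoFG) :
    IsClosed (g.range.comap (f : E →ₗ[𝕜] W) : Set E) := by
  let P : Submodule 𝕜 (E × V) := (f.coprod (-g)).ker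
  have : CompleteSpace P := (ContinuousLinearMap.isClosed_ker _).completeSpace_coe
  let p : P →L[𝕜] E := (ContinuousLinearMap.fst 𝕜 E V).comp P.subtypeL
  have mem_P (x : E) (u : V) : (x, u) ∈ P ↔ g u = f x := by
    change f x + -g u = 0 ↔ _
    rw [add_neg_eq_zero, eq_comm]
  have hp : p.range = g.range.comap (f : E →ₗ[𝕜] W) := by
    ext x
    constructor
    · rintro ⟨⟨⟨y, u⟩, hyu⟩, rfl⟩
      exact ⟨u, (mem_P y u).1 hyu⟩
    · rintro ⟨u, hu⟩
      exact ⟨⟨(x, u), (mem_P x u).2 hu⟩, rfl⟩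
  rw [← hp] at h ⊢
  exact isClosed_range_of_cofg p h

end ClosedRange

section Adjoint

variable {𝕜 E : Type*} [RCLike 𝕜] [NormedAddCommGroup E] [InnerProductSpace 𝕜 E]

-- Modulo `Wᗮ`, the operator `A` descends to an endomorphism `M` of the finite-dimensional space
-- `W`, and the formal adjoint of `A` on `W` is the adjoint of `M`.
theorem exists_inner_eq_of_orthogonal_invariant {A : E →ₗ.[𝕜] E} (hA : Dense (A.domain : Set E))
    {W : Submodule 𝕜 E} [FiniteDimensional 𝕜 W]
    (hinv : ∀ x : A.domain, (x : E) ∈ Wᗮ → A x ∈ Wᗮ) {w : E} (hw : w ∈ W) :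
    ∃ y ∈ W, ∀ x : A.domain, inner 𝕜 y (x : E) = inner 𝕜 w (A x) := by
  let P : E →L[𝕜] W := W.orthogonalProjectionOnto
  have hP : Function.Surjective P := fun v =>
    ⟨v, W.orthogonalProjectionOnto_mem_subspace_eq_self v⟩
  let p : A.domain →ₗ[𝕜] W := (P : E →ₗ[𝕜] W) ∘ₗ A.domain.subtype
  have hp : p.range = ⊤ := by
    have hdense : Dense (p.range : Set W) := by
      simpa [p, LinearMap.range_comp] using hP.denseRange.dense_image P.continuous hA
    exact SetLike.coe_injective
      ((p.range.closed_of_finiteDimensional.closure_eq).symm.trans hdense.closure_eq)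
  obtain ⟨σ, hσ⟩ := p.exists_rightInverse_of_surjective hp
  let M : W →ₗ[𝕜] W := (P : E →ₗ[𝕜] W) ∘ₗ A.toFun ∘ₗ σ
  have hM (x : A.domain) : P (A x) = M (P x) := by
    have hmem : ((x - σ (p x) : A.domain) : E) ∈ Wᗮ := by
      rw [← W.ker_orthogonalProjectionOnto]
      have : p (x - σ (p x)) = 0 := by
        rw [map_sub, sub_eq_zero]
        exact (LinearMap.congr_fun hσ (p x)).symm
      exact this
    have hzero : P (A (x - σ (p x))) = 0 := by
      have := hinv _ hmem
      rwa [← W.ker_orthogonalProjectionOnto] at this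
    rw [A.map_sub, map_sub, sub_eq_zero] at hzero
    exact hzero
  refine ⟨LinearMap.adjoint M ⟨w, hw⟩, Subtype.coe_prop _, fun x => ?_⟩
  calc inner 𝕜 (LinearMap.adjoint M ⟨w, hw⟩ : E) (x : E)
      = inner 𝕜 (LinearMap.adjoint M ⟨w, hw⟩) (P x) :=
        (W.inner_orthogonalProjectionOnto_eq_of_mem_left _ _).symm
    _ = inner 𝕜 (⟨w, hw⟩ : W) (M (P x)) := LinearMap.adjoint_inner_left _ _ _
    _ = inner 𝕜 (⟨w, hw⟩ : W) (P (A x)) := by rw [hM]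
    _ = inner 𝕜 w (A x) := W.inner_orthogonalProjectionOnto_eq_of_mem_left _ _

end Adjoint

section GenEigenSpan

variable {H : Type*} [NormedAddCommGroup H] [InnerProductSpace ℂ H]

theorem le_genEigenSpan_of_invariant (A : H →ₗ.[ℂ] H) (W : Submodule ℂ H)
    [FiniteDimensional ℂ W] (hdom : W ≤ A.domain)
    (hmap : ∀ w (hw : w ∈ W), A ⟨w, hdom hw⟩ ∈ W) : W ≤ genEigenSpan A := by
  let f : Module.End ℂ W := (A.toFun ∘ₗ Submodule.inclusion hdom).codRestrict W
    fun w => hmap w w.2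
  have hker (μ : ℂ) (k : ℕ) (w : W) (hw : ((f - algebraMap ℂ _ μ) ^ k) w = 0) :
      InKerPow A μ k (w : H) := by
    induction k generalizing w with
    | zero => simpa [InKerPow] using hw
    | succ k ih =>
      rw [pow_succ, Module.End.mul_apply] at hw
      exact ⟨hdom w.2, ih _ hw⟩
  have htop : ⊤ ≤ (genEigenSpan A).comap W.subtype := by
    rw [← Module.End.iSup_maxGenEigenspace_eq_top f]
    refine iSup_le fun μ w hw => ?_
    obtain ⟨k, hk⟩ := (Module.End.mem_maxGenEigenspace f μ w).1 hw
    exact Submodule.subset_span ⟨μ, k, hker μ k w hk⟩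
  exact fun w hw => htop (x := ⟨w, hw⟩) trivial

theorem le_genEigenSpan_adjoint_of_orthogonal_invariant [CompleteSpace H] {A : H →ₗ.[ℂ] H}
    (hA : Dense (A.domain : Set H)) {W : Submodule ℂ H} [FiniteDimensional ℂ W]
    (hinv : ∀ x : A.domain, (x : H) ∈ Wᗮ → A x ∈ Wᗮ) : W ≤ genEigenSpan A.adjoint := by
  have hexists {w : H} (hw : w ∈ W) := exists_inner_eq_of_orthogonal_invariant hA hinv hw
  have hdom : W ≤ A.adjoint.domain := fun w hw => by
    obtain ⟨y, -, hy⟩ := hexists hw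
    exact A.mem_adjoint_domain_of_exists w ⟨y, hy⟩
  refine le_genEigenSpan_of_invariant _ W hdom fun w hw => ?_
  obtain ⟨y, hyW, hy⟩ := hexists hw
  rwa [A.adjoint_apply_eq hA ⟨w, hdom hw⟩ hy]

end GenEigenSpan

namespace IsC0Semigroup

variable {H : Type*} [NormedAddCommGroup H] [InnerProductSpace ℂ H] {S : ℝ → H →L[ℂ] H}

theorem apply_add (hS : IsC0Semigroup S) {s t : ℝ} (hs : 0 ≤ s) (ht : 0 ≤ t) (x : H) :
    S (s + t) x = S s (S t x) :=
  DFunLike.congr_fun (hS.map_add s t hs ht) x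

theorem tendsto_zero (hS : IsC0Semigroup S) (x : H) :
    Tendsto (fun t => S t x) (𝓝[>] 0) (𝓝 x) := by
  simpa only [ContinuousWithinAt, hS.map_zero, ContinuousLinearMap.id_apply] using
    (hS.continuousOn x 0 self_mem_Ici).mono Ioi_subset_Ici_self

theorem continuous_max (hS : IsC0Semigroup S) (x : H) : Continuous fun t => S (max t 0) x :=
  (hS.continuousOn x).comp_continuous (by fun_prop) fun _ => mem_Ici.2 (le_max_right _ _)

theorem exists_norm_le [CompleteSpace H] (hS : IsC0Semigroup S) (T : ℝ) :
    ∃ M, ∀ t ∈ Icc 0 T, ‖S t‖ ≤ M := by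
  obtain ⟨M, hM⟩ := banach_steinhaus (g := fun t : Icc 0 T => S t) fun x => by
    obtain ⟨C, hC⟩ := isCompact_Icc.exists_bound_of_continuousOn
      ((hS.continuousOn x).mono (Icc_subset_Ici_self : Icc 0 T ⊆ _))
    exact ⟨C, fun t => hC t t.2⟩
  exact ⟨M, fun t ht => hM ⟨t, ht⟩⟩

theorem continuous_uncurry_max [CompleteSpace H] (hS : IsC0Semigroup S) :
    Continuous fun p : ℝ × H => S (max p.1 0) p.2 := by
  refine continuous_iff_continuousAt.2 fun ⟨t, x⟩ => ?_
  obtain ⟨M, hM⟩ := hS.exists_norm_le (max (t + 1) 0)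
  have hfst : Tendsto (fun p : ℝ × H => S (max p.1 0) x) (𝓝 (t, x)) (𝓝 (S (max t 0) x)) :=
    ((hS.continuous_max x).comp continuous_fst).tendsto (t, x)
  have hbound : Tendsto (fun p : ℝ × H => M * ‖p.2 - x‖) (𝓝 (t, x)) (𝓝 0) := by
    simpa using (show Continuous fun p : ℝ × H => M * ‖p.2 - x‖ by fun_prop).tendsto (t, x)
  have hdiff : Tendsto (fun p : ℝ × H => S (max p.1 0) (p.2 - x)) (𝓝 (t, x)) (𝓝 0) := by
    refine squeeze_zero_norm' ?_ hbound
    filter_upwards [(continuous_fst.tendsto (t, x)).eventually (gt_mem_nhds (lt_add_one t))]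
      with p hp
    exact (S _).le_of_opNorm_le (hM _ ⟨le_max_right _ _, max_le_max_right _ hp.le⟩) _
  simpa [ContinuousAt] using hfst.add hdiff

theorem apply_integral [CompleteSpace H] (hS : IsC0Semigroup S) (x : H) {h t : ℝ} (hh : 0 ≤ h)
    (ht : 0 ≤ t) :
    S h (∫ s in (0 : ℝ)..t, S (max s 0) x) = ∫ s in h..(t + h), S (max s 0) x := by
  have hg := hS.continuous_max x
  calc S h (∫ s in (0 : ℝ)..t, S (max s 0) x)
      = ∫ s in (0 : ℝ)..t, S h (S (max s 0) x) :=
        ((S h).intervalIntegral_comp_comm (hg.intervalIntegrable _ _)).symm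
    _ = ∫ s in (0 : ℝ)..t, S (max (s + h) 0) x := by
        refine intervalIntegral.integral_congr fun s hs => ?_
        rw [uIcc_of_le ht] at hs
        rw [← hS.apply_add hh (le_max_right _ _), max_eq_left hs.1,
          max_eq_left (add_nonneg hs.1 hh), add_comm]
    _ = ∫ s in h..(t + h), S (max s 0) x := by
        rw [intervalIntegral.integral_comp_add_right (fun s => S (max s 0) x), zero_add]

theorem tendsto_average [CompleteSpace H] (hS : IsC0Semigroup S) (x : H) {t : ℝ} (ht : 0 ≤ t) :
    Tendsto (fun h : ℝ => (h : ℂ)⁻¹ • ∫ s in t..(t + h), S (max s 0) x) (𝓝[>] 0)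
      (𝓝 (S t x)) := by
  have hg := hS.continuous_max x
  have hderiv := (hg.integral_hasStrictDerivAt t t).hasDerivAt.tendsto_slope_zero_right
  simpa only [intervalIntegral.integral_same, sub_zero, max_eq_left ht, ← Complex.coe_smul,
    Complex.ofReal_inv] using hderiv

end IsC0Semigroup

namespace Generates

variable {H : Type*} [NormedAddCommGroup H] [InnerProductSpace ℂ H] {A : H →ₗ.[ℂ] H}
  {S : ℝ → H →L[ℂ] H}

theorem mem_domain_of_tendsto (hAS : Generates A S) {x y : H}
    (h : Tendsto (fun t : ℝ => (t : ℂ)⁻¹ • (S t x - x)) (𝓝[>] 0) (𝓝 y)) : x ∈ A.domain :=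
  A.mem_domain_of_mem_graph ((hAS.mem_graph_iff x y).2 h)

theorem tendsto_apply (hAS : Generates A S) (x : A.domain) :
    Tendsto (fun t : ℝ => (t : ℂ)⁻¹ • (S t x - x)) (𝓝[>] 0) (𝓝 (A x)) :=
  (hAS.mem_graph_iff _ _).1 (A.mem_graph x)

theorem map_mem_of_invariant (hAS : Generates A S) {N : Submodule ℂ H}
    (hN : IsClosed (N : Set H)) (hinv : ∀ᶠ t in 𝓝[>] 0, ∀ x ∈ N, S t x ∈ N) (x : A.domain)
    (hx : (x : H) ∈ N) : A x ∈ N := by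
  refine hN.mem_of_tendsto (hAS.tendsto_apply x) ?_
  filter_upwards [hinv] with t ht
  exact N.smul_mem _ (N.sub_mem (ht x hx) hx)

theorem integral_mem_domain [CompleteSpace H] (hAS : Generates A S) (x : H) {t : ℝ}
    (ht : 0 ≤ t) : ∫ s in (0 : ℝ)..t, S (max s 0) x ∈ A.domain := by
  have hS := hAS.isC0Semigroup
  have hint (a b : ℝ) : IntervalIntegrable (fun s => S (max s 0) x) volume a b :=
    (hS.continuous_max x).intervalIntegrable a b
  refine hAS.mem_domain_of_tendsto
    (((hS.tendsto_average x ht).sub (hS.tendsto_average x le_rfl)).congr' ?_)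
  filter_upwards [self_mem_nhdsWithin] with h hh
  rw [hS.apply_integral x (le_of_lt hh) ht, ← smul_sub, zero_add,
    intervalIntegral.integral_interval_sub_interval_comm' (hint _ _) (hint _ _) (hint _ _)]

theorem dense_domain [CompleteSpace H] (hAS : Generates A S) : Dense (A.domain : Set H) := by
  intro x
  have haverage := hAS.isC0Semigroup.tendsto_average x le_rfl
  rw [hAS.isC0Semigroup.map_zero] at haverage
  refine mem_closure_of_tendsto haverage ?_
  filter_upwards [self_mem_nhdsWithin] with h hh
  rw [zero_add]
  exact A.domain.smul_mem _ (hAS.integral_mem_domain x (le_of_lt hh))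

theorem orthogonal_le_genEigenSpan_adjoint [CompleteSpace H] (hAS : Generates A S)
    {N : Submodule ℂ H} (hN : IsClosed (N : Set H)) (hfin : N.CoFG)
    (hinv : ∀ᶠ t in 𝓝[>] 0, ∀ x ∈ N, S t x ∈ N) : Nᗮ ≤ genEigenSpan A.adjoint := by
  have : CompleteSpace N := hN.completeSpace_coe
  have : FiniteDimensional ℂ Nᗮ := .of_fg (hfin.fg_of_isCompl N.isCompl_orthogonal)
  refine le_genEigenSpan_adjoint_of_orthogonal_invariant hAS.dense_domain ?_
  rw [N.orthogonal_orthogonal]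
  exact hAS.map_mem_of_invariant hN hinv

end Generates

section Control

theorem exists_integral_norm_le_mul_norm {α E : Type*} [MeasurableSpace α] [NormedAddCommGroup E]
    {p : ENNReal} (hp : 1 ≤ p) (μ : Measure α) [IsFiniteMeasure μ] :
    ∃ C, ∀ u : Lp E p μ, ∫ x, ‖u x‖ ∂μ ≤ C * ‖u‖ := by
  have hexponent : 0 ≤ 1 / (1 : ENNReal).toReal - 1 / p.toReal := by
    rcases eq_or_ne p ⊤ with rfl | hp'
    · simp
    · have : 1 ≤ p.toReal := by simpa using ENNReal.toReal_mono hp' hp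
      simpa using inv_le_one_of_one_le₀ this
  refine ⟨(μ univ ^ (1 / (1 : ENNReal).toReal - 1 / p.toReal)).toReal, fun u => ?_⟩
  calc ∫ x, ‖u x‖ ∂μ = (eLpNorm u 1 μ).toReal := by
        rw [integral_norm_eq_lintegral_enorm (Lp.aestronglyMeasurable u),
          eLpNorm_one_eq_lintegral_enorm]
    _ ≤ (μ univ ^ (1 / (1 : ENNReal).toReal - 1 / p.toReal) * eLpNorm u p μ).toReal := by
        rw [mul_comm]
        exact ENNReal.toReal_mono (ENNReal.mul_ne_top (Lp.eLpNorm_ne_top u)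
            (ENNReal.rpow_ne_top_of_nonneg hexponent (measure_ne_top _ _)))
          (eLpNorm_le_eLpNorm_mul_rpow_measure_univ hp (Lp.aestronglyMeasurable u))
    _ = _ := by rw [ENNReal.toReal_mul, Lp.norm_def]

theorem integrable_control {U : Type*} [NormedAddCommGroup U] {T : ℝ} (u : L2Control U T) :
    IntegrableOn u (Ioo 0 T) :=
  (Lp.memLp u).integrable one_le_two

/-- The extension-by-zero property of a family of control spaces `V T`, mapped into `L²(0,T; U)` by
`ι T`: a control on `(0, T)`, delayed by `a` and set to zero outside `(a, T + a)`, is a control on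
`(0, T + a + b)`. -/
def ExtendsByZero {U : Type*} [NormedAddCommGroup U] {V : ℝ → Type*}
    (ι : ∀ T, V T → L2Control U T) : Prop :=
  ∀ T a b : ℝ, 0 < T → 0 < a → 0 < b → ∀ u : V T, ∃ v : V (T + a + b),
    (ι (T + a + b) v : ℝ → U) =ᵐ[volume.restrict (Ioo (0 : ℝ) (T + a + b))]
      (Ioo a (T + a)).indicator (fun t => (ι T u : ℝ → U) (t - a))

namespace IsC0Semigroup

variable {H : Type*} [NormedAddCommGroup H] [InnerProductSpace ℂ H] [CompleteSpace H]
  {S : ℝ → H →L[ℂ] H}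

section NormedControl

variable {U : Type*} [NormedAddCommGroup U] [NormedSpace ℂ U]

theorem exists_norm_duhamel_le (hS : IsC0Semigroup S) (B : U →L[ℂ] H) (T : ℝ) :
    ∃ M, 0 ≤ M ∧ ∀ s ∈ Ioo 0 T, ∀ v, ‖S (T - s) (B v)‖ ≤ M * ‖v‖ := by
  obtain ⟨M, hM⟩ := hS.exists_norm_le T
  refine ⟨|M| * ‖B‖, by positivity, fun s hs v => ?_⟩
  have hSM : ‖S (T - s)‖ ≤ |M| :=
    (hM _ ⟨by linarith [hs.2], by linarith [hs.1]⟩).trans (le_abs_self M)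
  calc ‖S (T - s) (B v)‖ ≤ |M| * ‖B v‖ := (S _).le_of_opNorm_le hSM _
    _ ≤ |M| * (‖B‖ * ‖v‖) := by gcongr; exact B.le_opNorm v
    _ = |M| * ‖B‖ * ‖v‖ := (mul_assoc _ _ _).symm

theorem integrableOn_duhamel (hS : IsC0Semigroup S) (B : U →L[ℂ] H) {T : ℝ} {u : ℝ → U}
    (hu : IntegrableOn u (Ioo 0 T)) : IntegrableOn (fun s => S (T - s) (B (u s))) (Ioo 0 T) := by
  obtain ⟨M, -, hM⟩ := hS.exists_norm_duhamel_le B T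
  have hmeas : AEStronglyMeasurable (fun s => S (max (T - s) 0) (B (u s)))
      (volume.restrict (Ioo 0 T)) :=
    hS.continuous_uncurry_max.comp_aestronglyMeasurable
      (AEStronglyMeasurable.prodMk (by fun_prop)
        (B.continuous.comp_aestronglyMeasurable hu.aestronglyMeasurable))
  refine (hu.norm.const_mul M).mono' (hmeas.congr ?_) ?_
  all_goals filter_upwards [ae_restrict_mem measurableSet_Ioo] with s hs
  · rw [max_eq_left (by linarith [hs.2])]
  · exact hM s hs (u s)

/-- The input map `u ↦ ∫ s in 0..T, S (T - s) (B (u s))`: the state reached at time `T` from the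
state `0` with the control `u`. The integral is taken over `(0, T)`, where `u` is defined. -/
noncomputable def inputMap (hS : IsC0Semigroup S) (B : U →L[ℂ] H) (T : ℝ) :
    L2Control U T →L[ℂ] H :=
  LinearMap.mkContinuousOfExistsBound
    { toFun := fun u => ∫ s in Ioo 0 T, S (T - s) (B (u s))
      map_add' := fun u v => by
        rw [← integral_add (hS.integrableOn_duhamel B (integrable_control u))
          (hS.integrableOn_duhamel B (integrable_control v))]
        refine integral_congr_ae ?_
        filter_upwards [Lp.coeFn_add u v] with s hs
        rw [hs, Pi.add_apply, _root_.map_add, _root_.map_add]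
      map_smul' := fun c u => by
        rw [RingHom.id_apply, ← integral_smul]
        refine integral_congr_ae ?_
        filter_upwards [Lp.coeFn_smul c u] with s hs
        rw [hs, Pi.smul_apply, map_smul, map_smul] } <| by
    obtain ⟨M, hM₀, hM⟩ := hS.exists_norm_duhamel_le B T
    obtain ⟨C, hC⟩ :=
      exists_integral_norm_le_mul_norm (E := U) one_le_two (volume.restrict (Ioo 0 T))
    refine ⟨M * C, fun u => ?_⟩
    calc ‖∫ s in Ioo 0 T, S (T - s) (B (u s))‖ ≤ ∫ s in Ioo 0 T, M * ‖u s‖ := by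
          refine norm_integral_le_of_norm_le ((integrable_control u).norm.const_mul M) ?_
          filter_upwards [ae_restrict_mem measurableSet_Ioo] with s hs using hM s hs (u s)
      _ = M * ∫ s in Ioo 0 T, ‖u s‖ := integral_const_mul _ _
      _ ≤ M * (C * ‖u‖) := by gcongr; exact hC u
      _ = M * C * ‖u‖ := (mul_assoc _ _ _).symm

theorem inputMap_apply (hS : IsC0Semigroup S) (B : U →L[ℂ] H) {T : ℝ} (u : L2Control U T) :
    hS.inputMap B T u = ∫ s in Ioo 0 T, S (T - s) (B (u s)) :=
  rfl

theorem inputMap_congr_ae (hS : IsC0Semigroup S) (B : U →L[ℂ] H) {T : ℝ} {u : L2Control U T}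
    {v : ℝ → U} (h : u =ᵐ[volume.restrict (Ioo 0 T)] v) :
    hS.inputMap B T u = ∫ s in Ioo 0 T, S (T - s) (B (v s)) := by
  refine integral_congr_ae ?_
  filter_upwards [h] with s hs
  rw [hs]

theorem inputMap_extend (hS : IsC0Semigroup S) (B : U →L[ℂ] H) {T a b : ℝ} (hT : 0 ≤ T)
    (ha : 0 ≤ a) (hb : 0 ≤ b) (u : L2Control U T) (v : L2Control U (T + a + b))
    (h : v =ᵐ[volume.restrict (Ioo 0 (T + a + b))]
      (Ioo a (T + a)).indicator (fun t => u (t - a))) :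
    hS.inputMap B (T + a + b) v = S b (hS.inputMap B T u) := by
  have hindicator : (fun s => S (T + a + b - s) (B ((Ioo a (T + a)).indicator
      (fun t => u (t - a)) s))) =
      (Ioo a (T + a)).indicator fun s => S (T + a + b - s) (B (u (s - a))) := by
    ext s
    by_cases hs : s ∈ Ioo a (T + a) <;> simp [hs]
  have hdelay (s : ℝ) (hs : s ∈ Ioo a (T + a)) :
      S (T + a + b - s) (B (u (s - a))) = S b (S (T - (s - a)) (B (u (s - a)))) := by
    rw [← hS.apply_add hb (by linarith [hs.2])]
    ring_nf
  calc hS.inputMap B (T + a + b) v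
      = ∫ s in Ioo a (T + a), S (T + a + b - s) (B (u (s - a))) := by
        rw [hS.inputMap_congr_ae B h, hindicator, setIntegral_indicator measurableSet_Ioo,
          inter_eq_right.2 (Ioo_subset_Ioo ha (by linarith))]
    _ = ∫ s in Ioo a (T + a), S b (S (T - (s - a)) (B (u (s - a)))) :=
        setIntegral_congr_fun measurableSet_Ioo hdelay
    _ = ∫ s in Ioo 0 T, S b (S (T - s) (B (u s))) := by
        simp only [← integral_Ioc_eq_integral_Ioo]
        rw [← intervalIntegral.integral_of_le (by linarith), ← intervalIntegral.integral_of_le hT,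
          intervalIntegral.integral_comp_sub_right (fun s => S b (S (T - s) (B (u s)))), sub_self,
          add_sub_cancel_right]
    _ = S b (hS.inputMap B T u) :=
        (S b).integral_comp_comm (hS.integrableOn_duhamel B (integrable_control u))

/-- The states that can be reached at time `T` from the state `0` with controls in `V`, mapped into
`L²(0,T; U)` by `ι`. -/
noncomputable def reachableSpace (hS : IsC0Semigroup S) (B : U →L[ℂ] H) {T : ℝ} {V : Type*}
    [NormedAddCommGroup V] [NormedSpace ℂ V] (ι : V →L[ℂ] L2Control U T) : Submodule ℂ H :=
  ((hS.inputMap B T).comp ι).range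

end NormedControl

section HilbertControl

variable {U : Type*} [NormedAddCommGroup U] [InnerProductSpace ℂ U] {V : Type*}
  [NormedAddCommGroup V] [NormedSpace ℂ V]

theorem mildSolution_eq (hS : IsC0Semigroup S) (B : U →L[ℂ] H) {T : ℝ} (hT : 0 ≤ T) (f : H)
    (u : L2Control U T) : mildSolution S B f u T = S T f + hS.inputMap B T u := by
  rw [mildSolution, inputMap_apply, intervalIntegral.integral_of_le hT,
    integral_Ioc_eq_integral_Ioo]

theorem exists_mildSolution_eq_zero_iff (hS : IsC0Semigroup S) (B : U →L[ℂ] H) {T : ℝ}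
    (hT : 0 ≤ T) (ι : V →L[ℂ] L2Control U T) (f : H) :
    (∃ u, mildSolution S B f (ι u) T = 0) ↔ S T f ∈ hS.reachableSpace B ι := by
  rw [← neg_mem_iff]
  refine exists_congr fun u => ?_
  rw [hS.mildSolution_eq B hT, add_comm, add_eq_zero_iff_eq_neg]
  rfl

theorem map_le_sup_reachableSpace (hS : IsC0Semigroup S) (B : U →L[ℂ] H) {T : ℝ} (hT : 0 ≤ T)
    (ι : V →L[ℂ] L2Control U T) {F G : Submodule ℂ H}
    (h : ∀ f ∈ G, ∃ u, mildSolution S B f (ι u) T ∈ F) :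
    G.map (S T : H →ₗ[ℂ] H) ≤ F ⊔ hS.reachableSpace B ι := by
  rintro _ ⟨f, hf, rfl⟩
  obtain ⟨u, hu⟩ := h f hf
  rw [hS.mildSolution_eq B hT] at hu
  have hreach : hS.inputMap B T (ι u) ∈ hS.reachableSpace B ι := ⟨u, rfl⟩
  simpa only [add_neg_cancel_right, ContinuousLinearMap.coe_coe] using
    Submodule.add_mem_sup hu (neg_mem hreach)

-- With `ψ τ` the inner product of `w` with `S (s - τ) (B e)`, the control `conj (ψ τ) • e` turns
-- the hypothesis into `∫ ‖ψ‖² = 0`.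
theorem inner_apply_eq_zero_of_inputMap (hS : IsC0Semigroup S) (B : U →L[ℂ] H) {w : H} {s : ℝ}
    (hw : ∀ u, inner ℂ w (hS.inputMap B s u) = 0) (e : U) {t : ℝ} (ht : t ∈ Ioo 0 s) :
    inner ℂ w (S t (B e)) = 0 := by
  let ψ : ℝ → ℂ := fun τ => inner ℂ w (S (max (s - τ) 0) (B e))
  have hψ : Continuous ψ := continuous_const.inner ((hS.continuous_max (B e)).comp (by fun_prop))
  let φ : ℝ → U := fun τ => starRingEnd ℂ (ψ τ) • e
  have hφ : Continuous φ := by fun_prop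
  obtain ⟨C, hC⟩ := isCompact_Icc.exists_bound_of_continuousOn (s := Icc 0 s) hφ.continuousOn
  have hmem : MemLp φ 2 (volume.restrict (Ioo 0 s)) := by
    refine MemLp.of_bound hφ.aestronglyMeasurable C ?_
    filter_upwards [ae_restrict_mem measurableSet_Ioo] with τ hτ
    exact hC τ (Ioo_subset_Icc_self hτ)
  have hintegrand (τ : ℝ) (hτ : τ ∈ Ioo 0 s) :
      inner ℂ w (S (s - τ) (B (φ τ))) = ((‖ψ τ‖ ^ 2 : ℝ) : ℂ) := by
    have hmax : ψ τ = inner ℂ w (S (s - τ) (B e)) := by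
      simp only [ψ, max_eq_left (sub_nonneg.2 hτ.2.le)]
    rw [map_smul, map_smul, inner_smul_right, ← hmax, Complex.conj_mul', Complex.ofReal_pow]
  have hzero : ∫ τ in Ioo 0 s, ‖ψ τ‖ ^ 2 = 0 := by
    rw [← Complex.ofReal_eq_zero, ← integral_complex_ofReal,
      ← setIntegral_congr_fun measurableSet_Ioo hintegrand,
      integral_inner (hS.integrableOn_duhamel B (hmem.integrable one_le_two)),
      ← hS.inputMap_congr_ae B hmem.coeFn_toLp]
    exact hw _
  have hae : ψ =ᵐ[volume.restrict (Ioo 0 s)] fun _ => 0 := by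
    filter_upwards [(setIntegral_eq_zero_iff_of_nonneg_ae (.of_forall fun τ => sq_nonneg ‖ψ τ‖)
      ((hψ.norm.pow 2).integrableOn_Icc.mono_set Ioo_subset_Icc_self)).1 hzero] with τ hτ
    simpa using hτ
  have hψ_zero := Measure.eqOn_open_of_ae_eq hae isOpen_Ioo hψ.continuousOn continuousOn_const
    (show s - t ∈ Ioo 0 s from ⟨by linarith [ht.2], by linarith [ht.1]⟩)
  simpa only [ψ, sub_sub_cancel, max_eq_left ht.1.le] using hψ_zero

theorem adjoint_apply_eq_zero_of_reachableSpace [CompleteSpace U] (hS : IsC0Semigroup S)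
    (B : U →L[ℂ] H) {s : ℝ} {ι : V →L[ℂ] L2Control U s} (hι : DenseRange ι) {w : H}
    (hw : ∀ x ∈ hS.reachableSpace B ι, inner ℂ w x = 0) {t : ℝ} (ht : t ∈ Ioo 0 s) :
    ContinuousLinearMap.adjoint B (ContinuousLinearMap.adjoint (S t) w) = 0 := by
  have hinput (u : L2Control U s) : inner ℂ w (hS.inputMap B s u) = 0 := by
    refine hι.induction_on (p := fun u => inner ℂ w (hS.inputMap B s u) = 0) u
      (isClosed_eq (by fun_prop) continuous_const) fun v => hw _ ⟨v, rfl⟩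
  refine ext_inner_right ℂ fun e => ?_
  rw [inner_zero_left, ContinuousLinearMap.adjoint_inner_left,
    ContinuousLinearMap.adjoint_inner_left]
  exact hS.inner_apply_eq_zero_of_inputMap B hinput e ht

end HilbertControl

end IsC0Semigroup

end Control

section Stationarity

variable {H : Type*} [NormedAddCommGroup H] [InnerProductSpace ℂ H]

/-- The property of the reachable spaces `R t` that follows from extending controls by zero: a state
of `R t`, reached with a control that starts late by `t' - t - b > 0`, belongs to `R t'` after
evolving freely during a time `b`. -/
def IsDelayStable (S : ℝ → H →L[ℂ] H) (R : ℝ → Submodule ℂ H) : Prop :=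
  ∀ ⦃t b t' : ℝ⦄, 0 < t → 0 < b → t + b < t' → ∀ x ∈ R t, S b x ∈ R t'

/-- The initial states from which `0` is reached at time `t`, when `R t` is the space of states
reached at time `t` from `0`. -/
def nullStates (S : ℝ → H →L[ℂ] H) (R : ℝ → Submodule ℂ H) (t : ℝ) : Submodule ℂ H :=
  (R t).comap (S t : H →ₗ[ℂ] H)

variable {S : ℝ → H →L[ℂ] H} {R : ℝ → Submodule ℂ H}

theorem mem_nullStates {t : ℝ} {x : H} : x ∈ nullStates S R t ↔ S t x ∈ R t :=
  Iff.rfl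

namespace IsDelayStable

theorem comap_nullStates_le (hR : IsDelayStable S R) (hS : IsC0Semigroup S) {t a t' : ℝ}
    (ht : 0 < t) (ha : 0 < a) (h : t + a < t') :
    (nullStates S R t).comap (S a : H →ₗ[ℂ] H) ≤ nullStates S R t' := by
  intro x hx
  have hmem : S (t' - t - a) (S t (S a x)) ∈ R t' :=
    hR ht (by linarith) (by linarith) _ hx
  rw [← hS.apply_add ht.le ha.le, ← hS.apply_add (by linarith) (by linarith)] at hmem
  rwa [show t' - t - a + (t + a) = t' by ring] at hmem

theorem cofg_nullStates_and_finrank_le (hR : IsDelayStable S R) (hS : IsC0Semigroup S) {t t' : ℝ}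
    (ht : 0 < t) (htt' : t < t') (hfin : (nullStates S R t).CoFG) :
    (nullStates S R t').CoFG ∧ Module.finrank ℂ (H ⧸ nullStates S R t') ≤
      Module.finrank ℂ (H ⧸ nullStates S R t) := by
  obtain ⟨a, ha, hat⟩ := exists_between (sub_pos.2 htt')
  have hle := hR.comap_nullStates_le hS ht ha (lt_sub_iff_add_lt'.1 hat)
  have hcomap := cofg_comap (S a : H →ₗ[ℂ] H) (nullStates S R t)
  exact ⟨hcomap.of_le hle,
    (finrank_quotient_le_of_le hle).trans (finrank_quotient_comap_le _ _)⟩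

theorem exists_nullStates_eq (hR : IsDelayStable S R) (hS : IsC0Semigroup S) {T₀ T : ℝ}
    (hT₀ : 0 < T₀) (hT : T₀ < T) (hfin : (nullStates S R T₀).CoFG)
    (hclosed : ∀ t, (nullStates S R t).CoFG → IsClosed (nullStates S R t : Set H)) :
    ∃ T₁ ∈ Ioo T₀ T, (nullStates S R T₁).CoFG ∧
      ∀ t ∈ Ioo T₁ T, nullStates S R t = nullStates S R T₁ := by
  have hcofg {t : ℝ} (ht : T₀ < t) := (hR.cofg_nullStates_and_finrank_le hS hT₀ ht hfin).1
  obtain ⟨T₁, hT₁, hmin⟩ := exists_minimalFor_of_wellFoundedLT (· ∈ Ioo T₀ T)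
    (fun t => Module.finrank ℂ (H ⧸ nullStates S R t)) (nonempty_Ioo.2 hT)
  have hT₁_pos : 0 < T₁ := hT₀.trans hT₁.1
  have hfin₁ := hcofg hT₁.1
  refine ⟨T₁, hT₁, hfin₁, fun t ht => ?_⟩
  have hmono := (hR.cofg_nullStates_and_finrank_le hS hT₁_pos ht.1 hfin₁).2
  have hle_rank := hmin ⟨hT₁.1.trans ht.1, ht.2⟩ hmono
  have hcomap (a : ℝ) (ha : a ∈ Ioo 0 (t - T₁)) :
      (nullStates S R T₁).comap (S a : H →ₗ[ℂ] H) = nullStates S R t := by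
    have hcofg_comap := cofg_comap (S a : H →ₗ[ℂ] H) (nullStates S R T₁)
    exact eq_of_le_of_finrank_quotient_le
      (hR.comap_nullStates_le hS hT₁_pos ha.1 (by linarith [ha.2]))
      ((finrank_quotient_comap_le _ _).trans hle_rank)
  have hle : nullStates S R t ≤ nullStates S R T₁ := fun x hx => by
    refine (hclosed T₁ hfin₁).mem_of_tendsto (hS.tendsto_zero x) ?_
    filter_upwards [Ioo_mem_nhdsGT (sub_pos.2 ht.1)] with a ha
    exact (hcomap a ha).ge hx
  have hfin_t := hcofg (hT₁.1.trans ht.1)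
  exact eq_of_le_of_finrank_quotient_le hle hmono

theorem comap_nullStates_eq (hR : IsDelayStable S R) (hS : IsC0Semigroup S) {T₁ T : ℝ}
    (hT₁ : 0 < T₁) (hfin : (nullStates S R T₁).CoFG)
    (hconst : ∀ t ∈ Ioo T₁ T, nullStates S R t = nullStates S R T₁) {a : ℝ}
    (ha : a ∈ Ioo 0 (T - T₁)) :
    (nullStates S R T₁).comap (S a : H →ₗ[ℂ] H) = nullStates S R T₁ := by
  have hcofg_comap := cofg_comap (S a : H →ₗ[ℂ] H) (nullStates S R T₁)
  obtain ⟨t, hat, htT⟩ := exists_between (show T₁ + a < T by linarith [ha.2])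
  have hle := hR.comap_nullStates_le hS hT₁ ha.1 hat
  rw [hconst t ⟨by linarith [ha.1], htT⟩] at hle
  exact eq_of_le_of_finrank_quotient_le hle (finrank_quotient_comap_le _ _)

-- A delayed copy `S δ r` of `r ∈ R s` differs from a null state by some `S (s + 2 * δ) x`. Running
-- the semigroup further shows that `x` is a null state, hence so is `r`.
theorem le_nullStates (hR : IsDelayStable S R) (hS : IsC0Semigroup S) {T₁ T : ℝ}
    (hT₁ : 0 < T₁) (hfin : (nullStates S R T₁).CoFG)
    (hconst : ∀ t ∈ Ioo T₁ T, nullStates S R t = nullStates S R T₁) {s : ℝ}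
    (hs : s ∈ Ioo 0 (T - T₁)) : R s ≤ nullStates S R T₁ := by
  intro r hr
  obtain ⟨hs₀, hsT⟩ := hs
  obtain ⟨δ, hδ, rfl⟩ : ∃ δ, 0 < δ ∧ T = T₁ + s + 4 * δ :=
    ⟨(T - T₁ - s) / 4, by linarith, by ring⟩
  have hinv {a : ℝ} (ha : 0 < a) (haT : a < s + 4 * δ) (x : H) :
      S a x ∈ nullStates S R T₁ ↔ x ∈ nullStates S R T₁ :=
    SetLike.ext_iff.1 (hR.comap_nullStates_eq hS hT₁ hfin hconst ⟨ha, by linarith⟩) x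
  have hcomap := hR.comap_nullStates_eq hS hT₁ hfin hconst (a := s + 2 * δ)
    ⟨by linarith, by linarith⟩
  obtain ⟨x, hx⟩ := exists_map_sub_mem_of_comap_eq hcomap (-S δ r)
  replace hx : S (s + 2 * δ) x + S δ r ∈ nullStates S R T₁ := by
    simpa only [ContinuousLinearMap.coe_coe, sub_neg_eq_add] using hx
  have hsum : S (T₁ + s + 3 * δ) x + S (T₁ + 2 * δ) r ∈ R (T₁ + s + 3 * δ) := by
    have hmem := hR hT₁ hδ (t' := T₁ + s + 3 * δ) (by linarith) _ (mem_nullStates.1 hx)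
    rw [← hS.apply_add hδ.le hT₁.le, _root_.map_add, ← hS.apply_add (by linarith) (by linarith),
      ← hS.apply_add (by linarith) hδ.le] at hmem
    convert hmem using 4 <;> ring
  have hr_delayed : S (T₁ + 2 * δ) r ∈ R (T₁ + s + 3 * δ) :=
    hR hs₀ (by linarith) (by linarith) r hr
  have hx_mem : x ∈ nullStates S R T₁ := by
    rw [← hconst (T₁ + s + 3 * δ) ⟨by linarith, by linarith⟩]
    exact (Submodule.add_mem_iff_left _ hr_delayed).1 hsum
  have hSx := (hinv (a := s + 2 * δ) (by linarith) (by linarith) x).2 hx_mem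
  exact (hinv hδ (by linarith) r).1 ((Submodule.add_mem_iff_right _ hSx).1 hx)

end IsDelayStable

end Stationarity

theorem isDelayStable_reachableSpace {H : Type*} [NormedAddCommGroup H] [InnerProductSpace ℂ H]
    [CompleteSpace H] {S : ℝ → H →L[ℂ] H} (hS : IsC0Semigroup S) {U : Type*}
    [NormedAddCommGroup U] [NormedSpace ℂ U] (B : U →L[ℂ] H) {V : ℝ → Type*}
    [∀ T, NormedAddCommGroup (V T)] [∀ T, NormedSpace ℂ (V T)] {ι : ∀ T, V T →L[ℂ] L2Control U T}
    (hext : ExtendsByZero fun T u => ι T u) :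
    IsDelayStable S fun t => hS.reachableSpace B (ι t) := by
  rintro t b t' ht hb htt' _ ⟨u, rfl⟩
  obtain ⟨a, ha, rfl⟩ : ∃ a, 0 < a ∧ t' = t + a + b := ⟨t' - t - b, by linarith, by ring⟩
  obtain ⟨v, hv⟩ := hext t a b ht ha hb u
  exact ⟨v, hS.inputMap_extend B ht.le ha.le hb.le _ _ hv⟩

theorem mainTheorem9_general {H : Type*} [NormedAddCommGroup H] [InnerProductSpace ℂ H]
    [CompleteSpace H] {U : Type*} [NormedAddCommGroup U] [InnerProductSpace ℂ U] [CompleteSpace U]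
    {T₀ : ℝ} (hT₀ : 0 < T₀) {A : H →ₗ.[ℂ] H} {S : ℝ → H →L[ℂ] H} (hAS : Generates A S)
    (B : U →L[ℂ] H) {V : ℝ → Type*} [∀ T, NormedAddCommGroup (V T)] [∀ T, NormedSpace ℂ (V T)]
    [∀ T, CompleteSpace (V T)] (ι : ∀ T, V T →L[ℂ] L2Control U T)
    (hι : ∀ T, 0 < T → DenseRange (ι T)) (hext : ExtendsByZero fun T u => ι T u)
    {F G : Submodule ℂ H} (hF : F.FG) (hG : G.CoFG)
    (hcontrol : ∀ f₀ ∈ G, ∃ u, mildSolution S B f₀ (ι T₀ u) T₀ ∈ F)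
    (huc : ∀ ε : ℝ, 0 < ε → ∀ g₀ ∈ genEigenSpan A.adjoint,
      (∀ t ∈ Ioo 0 ε,
        ContinuousLinearMap.adjoint B (ContinuousLinearMap.adjoint (S t) g₀) = 0) → g₀ = 0)
    {T : ℝ} (hT : T₀ < T) (f₀ : H) : ∃ u, mildSolution S B f₀ (ι T u) T = 0 := by
  have hS := hAS.isC0Semigroup
  have hR := isDelayStable_reachableSpace hS B hext
  obtain ⟨T₁, ⟨hT₀₁, hT₁⟩, hfin, hconst⟩ := hR.exists_nullStates_eq hS hT₀ hT
    (cofg_comap_of_map_le_sup hG hF (hS.map_le_sup_reachableSpace B hT₀.le (ι T₀) hcontrol))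
    fun t => isClosed_comap_range_of_cofg (S t) ((hS.inputMap B t).comp (ι t))
  have hT₁_pos : 0 < T₁ := hT₀.trans hT₀₁
  set N := nullStates S (fun t => hS.reachableSpace B (ι t)) T₁
  have hclosed : IsClosed (N : Set H) := isClosed_comap_range_of_cofg _ _ hfin
  have hinv : ∀ᶠ t in 𝓝[>] 0, ∀ x ∈ N, S t x ∈ N := by
    filter_upwards [Ioo_mem_nhdsGT (sub_pos.2 hT₁)] with a ha
    exact (hR.comap_nullStates_eq hS hT₁_pos hfin hconst ha).ge
  obtain ⟨s, hs⟩ := exists_between (sub_pos.2 hT₁)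
  have htop : N = ⊤ := by
    have : CompleteSpace N := hclosed.completeSpace_coe
    refine N.orthogonal_eq_bot_iff.1 ((Submodule.eq_bot_iff _).2 fun w hw => ?_)
    have hspan := hAS.orthogonal_le_genEigenSpan_adjoint hclosed hfin hinv hw
    refine huc s hs.1 w hspan fun t ht => ?_
    refine hS.adjoint_apply_eq_zero_of_reachableSpace B (hι s hs.1) (fun x hx => ?_) ht
    exact N.inner_left_of_mem_orthogonal (hR.le_nullStates hS hT₁_pos hfin hconst hs hx) hw
  rw [hS.exists_mildSolution_eq_zero_iff B (hT₀.trans hT).le]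
  exact hR.comap_nullStates_le hS hT₁_pos hs.1 (lt_sub_iff_add_lt'.1 hs.2)
    (htop ▸ Submodule.mem_top : S s f₀ ∈ N)

theorem mainTheorem9
    {H : Type*} [NormedAddCommGroup H] [InnerProductSpace ℂ H] [CompleteSpace H]
    {U : Type*} [NormedAddCommGroup U] [InnerProductSpace ℂ U] [CompleteSpace U]
    (T₀ : ℝ) (hT₀ : 0 < T₀)
    -- the operator `A`, the semigroup `S t = e^{tA}` it generates, the control operator `B`
    (A : H →ₗ.[ℂ] H) (S : ℝ → H →L[ℂ] H) (hAS : Generates A S)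
    (B : U →L[ℂ] H)
    -- the Hilbert spaces `U_T`, with their continuous dense injections into `L²(0,T; U)`
    (UT : ℝ → Type*) [∀ T, NormedAddCommGroup (UT T)] [∀ T, InnerProductSpace ℂ (UT T)]
    [∀ T, CompleteSpace (UT T)]
    (ι : ∀ T : ℝ, UT T →L[ℂ] L2Control U T)
    (hι_inj : ∀ T : ℝ, 0 < T → Function.Injective (ι T))
    (hι_dense : ∀ T : ℝ, 0 < T → DenseRange (ι T))
    -- extension by zero
    (hext : ∀ T a b : ℝ, 0 < T → 0 < a → 0 < b → ∀ u : UT T, ∃ v : UT (T + a + b),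
      (ι (T + a + b) v : ℝ → U) =ᵐ[volume.restrict (Ioo (0 : ℝ) (T + a + b))]
        (Ioo a (T + a)).indicator (fun t => (ι T u : ℝ → U) (t - a)))
    -- control up to finite dimension
    (F : Submodule ℂ H) (hF : FiniteDimensional ℂ F)
    (hFS : ∀ t : ℝ, 0 ≤ t → ∀ x ∈ F, S t x ∈ F)
    (G : Submodule ℂ H) (hG_closed : IsClosed (G : Set H)) (hG : FiniteDimensional ℂ (H ⧸ G))
    (hcontrol : ∀ f₀ ∈ G, ∃ u : UT T₀, mildSolution S B f₀ (ι T₀ u) T₀ ∈ F)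
    -- unique continuation
    (huc : ∀ ε : ℝ, 0 < ε → ∀ g₀ ∈ genEigenSpan A.adjoint,
      (∀ t ∈ Ioo (0 : ℝ) ε,
        ContinuousLinearMap.adjoint B (ContinuousLinearMap.adjoint (S t) g₀) = 0) → g₀ = 0) :
    ∀ T : ℝ, T₀ < T → ∀ f₀ : H, ∃ u : UT T, mildSolution S B f₀ (ι T u) T = 0 :=
  fun _ => mainTheorem9_general hT₀ hAS B ι hι_dense hext (Module.Finite.iff_fg.1 hF) hG hcontrol
    huc
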